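/- Let $K$ be a field of characteristic zero (for instance $K=\mathbb R$). For a commutative $K$-algebra $A$ let $A\langle\langle X\rangle\rangle$ be the formal power series in the noncommuting letters $X=\{x_0,x_1\}$, with empty word $\emptyset$ and shuffle product $\sqcup\!\sqcup$. Let $G(A)$ be the set of pairs $\mathbf c=c_1e_1+c_2e_2$ with $c_1,c_2\in A\langle\langle X\rangle\rangle$ and constant coefficient $c_1(\emptyset)=1$, and put $\mathbf e=\emptyset e_1$. For a series $c$ and a pair $\mathbf d$ define the mixed composition $c\triangleleft\mathbf d=\sum_\eta c(\eta)\,(\eta\triangleleft\mathbf d)$ by $$\emptyset\triangleleft\mathbf d=\emptyset,\qquad x_0\eta\triangleleft\mathbf d=x_0(\eta\triangleleft\mathbf d),\qquad x_1\eta\triangleleft\mathbf d=x_1\bigl(d_1\mathbin{\sqcup\!\sqcup}(\eta\triangleleft\mathbf d)\bigr)+x_0\bigl(d_2\mathbin{\sqcup\!\sqcup}(\eta\triangleleft\mathbf d)\bigr),$$ and for pairs put $\mathbf c\triangleleft\mathbf d=(c_1\triangleleft\mathbf d)e_1+(c_2\triangleleft\mathbf d)e_2$. Then $G(A)$ is a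 group with identity $\mathbf e$ under $$\mathbf c\cdot\mathbf d=(c_1\mathbin{\sqcup\!\sqcup}d_1)e_1+(c_2+c_1\mathbin{\sqcup\!\sqcup}d_2)e_2,$$ and $(G,\star)$ with $\mathbf c\star\mathbf d=(\mathbf c\triangleleft\mathbf d)\cdot\mathbf d$ is also a group with identity $\mathbf e$, the affine feedback group. The tangent space of $G$ at $\mathbf e$ is $$\mathfrak g=\{u_1e_1+u_2e_2:\ u_1,u_2\in K\langle\langle X\rangle\rangle,\ u_1(\emptyset)=0\},$$ where $u\in\mathfrak g$ corresponds to $\mathbf e+\varepsilon u\in\ker\bigl(G(K[\varepsilon]/\varepsilon^2)\to G(K)\bigr)$. Let $K[\varepsilon_1,\varepsilon_2]$ be the ring with $\varepsilon_1^2=\varepsilon_2^2=0$. The Lie bracket of either group structure on $G$ sends $(u,v)$ to the coefficient of $\varepsilon_1\varepsilon_2$ in the group commutator (in $G(K[\varepsilon_1,\varepsilon_2])$) of $\mathbf e+\varepsilon_1u$ and $\mathbf e+\varepsilon_2v$. Let $[\cdot,\cdot]$ be the Lie bracket of $(G,\cdot)$, and let $\curvearrowleft$ be the differential of $\triangleleft$,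 that is, $u\curvearrowleft v$ is the coefficient of $\varepsilon_1\varepsilon_2$ in $(\mathbf e+\varepsilon_1u)\triangleleft(\mathbf e+\varepsilon_2v)$. Put $$[\![x,y]\!]=x\curvearrowleft y-y\curvearrowleft x+[x,y].$$ **Theorem.** 1. For all $u,v\in\mathfrak g$ the commutator of $\mathbf e+\varepsilon_1u$ and $\mathbf e+\varepsilon_2v$ in $(G,\cdot)$ is $\mathbf e+\varepsilon_1\varepsilon_2[u,v]$, and $$[\eta e_i,\zeta e_j]=\delta_{i1}(\eta\mathbin{\sqcup\!\sqcup}\zeta)e_j-\delta_{j1}(\eta\mathbin{\sqcup\!\sqcup}\zeta)e_i$$ for all $i,j\in\{1,2\}$ and all words (more generally, all series) $\eta,\zeta$ with $\eta e_i,\zeta e_j\in\mathfrak g$. Moreover $(\mathbf e+\varepsilon_1u)\triangleleft(\mathbf e+\varepsilon_2v)=\mathbf e+\varepsilon_1u+\varepsilon_1\varepsilon_2(u\curvearrowleft v)$. 2. $(\mathfrak g,[\cdot,\cdot],\curvearrowleft)$ is a (right) post-Lie algebra: $[\cdot,\cdot]$ is a Lie bracket over $K$, $\curvearrowleft$ is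 bilinear, and for all $x,y,z\in\mathfrak g$ $$[x,y]\curvearrowleft z=[x\curvearrowleft z,y]+[x,y\curvearrowleft z],$$ $$z\curvearrowleft[x,y]=\bigl((z\curvearrowleft x)\curvearrowleft y-z\curvearrowleft(x\curvearrowleft y)\bigr)-\bigl((z\curvearrowleft y)\curvearrowleft x-z\curvearrowleft(y\curvearrowleft x)\bigr).$$ 3. $[\![\cdot,\cdot]\!]$ is a Lie bracket on $\mathfrak g$, and $(\mathfrak g,[\![\cdot,\cdot]\!])$ is the Lie algebra of the affine feedback group $(G,\star)$: for all $u,v\in\mathfrak g$, $[\![u,v]\!]$ is the Lie bracket of $u$ and $v$ for $(G,\star)$, and the commutator of $\mathbf e+\varepsilon_1u$ and $\mathbf e+\varepsilon_2v$ in $(G,\star)$ is $\mathbf e+\varepsilon_1\varepsilon_2[\![u,v]\!]$. -/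

import Mathlib

namespace AffineFeedback

/-- Noncommutative formal power series `A⟨⟨x₀, x₁⟩⟩`: a series is its family of coefficients,
indexed by the words over the alphabet `{x₀, x₁}`; the empty word is `[]`. -/
def Series (A : Type*) : Type _ := List (Fin 2) → A

namespace Series

variable {A : Type*}

@[ext] theorem ext {c d : Series A} (h : ∀ w, c w = d w) : c = d := funext h

/-- The series `∑_w c(x w) w`, obtained by removing the first letter `x`. -/
def strip (x : Fin 2) (c : Series A) : Series A := fun w => c (x :: w)

theorem strip_apply (x : Fin 2) (c : Series A) (w : List (Fin 2)) : strip x c w = c (x :: w) := rfl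

/-- Two series have the same coefficients on all words of length at most `n`. -/
def Agree (n : ℕ) (c d : Series A) : Prop := ∀ w : List (Fin 2), w.length ≤ n → c w = d w

theorem eq_of_agree {c d : Series A} (h : ∀ n, Agree n c d) : c = d :=
  ext fun w => h w.length w le_rfl

theorem Agree.succ {n : ℕ} {c d : Series A} (h : c [] = d [])
    (h0 : Agree n (strip 0 c) (strip 0 d)) (h1 : Agree n (strip 1 c) (strip 1 d)) :
    Agree (n + 1) c d := by
  rintro (_ | ⟨x, w⟩) hw
  · exact h
  · have hw' : w.length ≤ n := by simpa using hw
    fin_cases x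
    · exact h0 w hw'
    · exact h1 w hw'

section Ring

variable [CommRing A]

instance : AddCommGroup (Series A) := inferInstanceAs (AddCommGroup (List (Fin 2) → A))

instance : Module A (Series A) := inferInstanceAs (Module A (List (Fin 2) → A))

/-- The series `x c`, obtained by putting the letter `x` in front of every word. -/
def pre (x : Fin 2) (c : Series A) : Series A
  | [] => 0
  | y :: w => if y = x then c w else 0

/-- The value `(c ⊗ d)(Δ w)`, where `Δ` is the unshuffle coproduct, that is, the morphism for
concatenation with `Δ x = x ⊗ 1 + 1 ⊗ x` for each letter `x`. -/
def shuffleCoeff : List (Fin 2) → Series A → Series A → A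
  | [], c, d => c [] * d []
  | x :: w, c, d => shuffleCoeff w (strip x c) d + shuffleCoeff w c (strip x d)

/-- The product of series is the shuffle product (not concatenation). -/
instance : Mul (Series A) := ⟨fun c d w => shuffleCoeff w c d⟩

/-- The unit is the series of the empty word. -/
instance : One (Series A) := ⟨fun w => if w = [] then 1 else 0⟩

theorem add_apply (c d : Series A) (w : List (Fin 2)) : (c + d) w = c w + d w := rfl
theorem neg_apply (c : Series A) (w : List (Fin 2)) : (-c) w = -c w := rfl
theorem sub_apply (c d : Series A) (w : List (Fin 2)) : (c - d) w = c w - d w := rfl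
theorem zero_apply (w : List (Fin 2)) : (0 : Series A) w = 0 := rfl
theorem smul_apply (r : A) (c : Series A) (w : List (Fin 2)) : (r • c) w = r * c w := rfl
theorem one_nil : (1 : Series A) [] = 1 := rfl
theorem one_cons (x : Fin 2) (w : List (Fin 2)) : (1 : Series A) (x :: w) = 0 := rfl
theorem mul_nil (c d : Series A) : (c * d) [] = c [] * d [] := rfl
theorem mul_cons (c d : Series A) (x : Fin 2) (w : List (Fin 2)) :
    (c * d) (x :: w) = (strip x c * d) w + (c * strip x d) w := rfl
theorem strip_mul (x : Fin 2) (c d : Series A) :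
    strip x (c * d) = strip x c * d + c * strip x d := rfl
theorem strip_add (x : Fin 2) (c d : Series A) : strip x (c + d) = strip x c + strip x d := rfl
theorem strip_smul (x : Fin 2) (r : A) (c : Series A) : strip x (r • c) = r • strip x c := rfl
theorem strip_zero (x : Fin 2) : strip x (0 : Series A) = 0 := rfl
theorem strip_one (x : Fin 2) : strip x (1 : Series A) = 0 := rfl

theorem shuffle_comm (c d : Series A) : c * d = d * c := by
  ext w
  induction w generalizing c d with
  | nil => simp only [mul_nil]; ring
  | cons x w ih => rw [mul_cons, mul_cons, ih, ih c]; ring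

theorem shuffle_add (c d e : Series A) : c * (d + e) = c * d + c * e := by
  ext w
  induction w generalizing c d e with
  | nil => simp only [mul_nil, add_apply]; ring
  | cons x w ih =>
    simp only [mul_cons, add_apply, strip_add, ih]; ring

theorem add_shuffle (c d e : Series A) : (c + d) * e = c * e + d * e := by
  rw [shuffle_comm, shuffle_add, shuffle_comm e, shuffle_comm e]

theorem shuffle_smul (r : A) (c d : Series A) : c * (r • d) = r • (c * d) := by
  ext w
  induction w generalizing c d with
  | nil => simp only [mul_nil, smul_apply]; ring
  | cons x w ih => simp only [mul_cons, strip_smul, ih, smul_apply]; ring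

theorem shuffle_zero (c : Series A) : c * 0 = 0 := by
  have := shuffle_smul (0 : A) c 0
  simpa using this

theorem shuffle_assoc (c d e : Series A) : c * d * e = c * (d * e) := by
  ext w
  induction w generalizing c d e with
  | nil => simp only [mul_nil]; ring
  | cons x w ih =>
    simp only [mul_cons, strip_mul, add_shuffle, shuffle_add, add_apply, ih]; ring

theorem shuffle_one (c : Series A) : c * 1 = c := by
  ext w
  induction w generalizing c with
  | nil => simp only [mul_nil, one_nil, mul_one]
  | cons x w ih =>
    rw [mul_cons, strip_one, shuffle_zero, ih, zero_apply, add_zero, strip_apply]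

/-- The commutative algebra of series under the shuffle product. -/
instance : CommRing (Series A) where
  __ := (inferInstance : AddCommGroup (Series A))
  mul_assoc := shuffle_assoc
  mul_comm := shuffle_comm
  one_mul c := by rw [shuffle_comm, shuffle_one]
  mul_one := shuffle_one
  left_distrib := shuffle_add
  right_distrib := add_shuffle
  zero_mul c := by rw [shuffle_comm, shuffle_zero]
  mul_zero := shuffle_zero

theorem Agree.add {n : ℕ} {c c' d d' : Series A} (h : Agree n c c') (h' : Agree n d d') :
    Agree n (c + d) (c' + d') := fun w hw => by rw [add_apply, add_apply, h w hw, h' w hw]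

theorem Agree.mul_left {n : ℕ} {d d' : Series A} (c : Series A) (h : Agree n d d') :
    Agree n (c * d) (c * d') := by
  intro w hw
  induction w generalizing n c d d' with
  | nil => rw [mul_nil, mul_nil, h [] (by simp)]
  | cons x w ih =>
    obtain ⟨m, rfl⟩ : ∃ m, n = m + 1 := ⟨n - 1, by simp at hw; omega⟩
    have hw' : w.length ≤ m := by simpa using hw
    rw [mul_cons, mul_cons, ih (strip x c) h (by omega),
      ih (d := strip x d) (d' := strip x d') (n := m) c
        (fun v hv => h (x :: v) (by simpa using hv)) hw']

theorem Agree.mul {n : ℕ} {c c' d d' : Series A} (h : Agree n c c') (h' : Agree n d d') :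
    Agree n (c * d) (c' * d') := by
  intro w hw
  rw [(h'.mul_left c) w hw, mul_comm, (h.mul_left d') w hw, mul_comm]

theorem sum_apply {ι : Type*} (s : Finset ι) (f : ι → Series A) (w : List (Fin 2)) :
    (∑ i ∈ s, f i) w = ∑ i ∈ s, f i w := Finset.sum_apply w s f

theorem pow_apply_eq_zero {p : Series A} (hp : p [] = 0) (n : ℕ) (w : List (Fin 2))
    (hw : w.length < n) : (p ^ n) w = 0 := by
  have key : ∀ (w : List (Fin 2)) (n : ℕ) (s : Series A),
      (∀ v : List (Fin 2), v.length < n → s v = 0) → w.length < n + 1 → (p * s) w = 0 := by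
    intro w
    induction w with
    | nil => intro n s _ _; rw [mul_nil, hp, zero_mul]
    | cons x w ih =>
      intro n s hs hw
      obtain ⟨m, rfl⟩ : ∃ m, n = m + 1 := ⟨n - 1, by simp at hw; omega⟩
      have hw' : w.length < m + 1 := by simpa using hw
      rw [mul_cons, ih m (strip x s) (fun v hv => hs (x :: v) (by simpa using hv)) hw',
        (Agree.mul_left (n := m) (d' := 0) (strip x p)
          (fun v hv => hs v (by omega))) w (by omega), mul_zero, zero_apply, add_zero]
  induction n generalizing w with
  | zero => omega
  | succ n ih => rw [pow_succ']; exact key w n _ ih hw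

/-- The shuffle inverse `∑ₙ (1 - c)ⁿ` of a series with constant coefficient `1`; powers beyond
the length of a word do not contribute to its coefficient. -/
def inv (c : Series A) : Series A :=
  fun w => (∑ n ∈ Finset.range (w.length + 1), (1 - c) ^ n) w

theorem mul_inv {c : Series A} (hc : c [] = 1) : c * inv c = 1 := by
  have hp : (1 - c) [] = 0 := by rw [sub_apply, one_nil, hc, sub_self]
  refine eq_of_agree fun N => ?_
  have h : Agree N (inv c) (∑ n ∈ Finset.range (N + 1), (1 - c) ^ n) := by
    intro w hw
    unfold inv
    rw [sum_apply, sum_apply]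
    refine Finset.sum_subset (fun i hi => ?_) (fun i _ hi => ?_)
    · simp only [Finset.mem_range] at hi ⊢; omega
    · exact pow_apply_eq_zero hp i w (by simp only [Finset.mem_range] at hi; omega)
  intro w hw
  rw [(h.mul_left c) w hw]
  have h2 := mul_neg_geom_sum (1 - c) (N + 1)
  rw [sub_sub_cancel] at h2
  rw [h2, sub_apply, pow_apply_eq_zero hp _ w (by omega), sub_zero]

theorem inv_nil {c : Series A} : inv c [] = 1 := by
  unfold inv
  rw [sum_apply]
  simp [one_nil]

/-- The mixed composition `η ◁ d` of a word `η` with a pair of series `d = (d₁, d₂)`. -/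
def wordMix (d₁ d₂ : Series A) : List (Fin 2) → Series A
  | [] => 1
  | 0 :: η => pre 0 (wordMix d₁ d₂ η)
  | 1 :: η => pre 1 (d₁ * wordMix d₁ d₂ η) + pre 0 (d₂ * wordMix d₁ d₂ η)

/-- The mixed composition `c ◁ d = ∑_η c(η) (η ◁ d)`; each coefficient is a finite sum, by
`wordMix_eq_zero`. -/
noncomputable def mix (c d₁ d₂ : Series A) : Series A :=
  fun w => ∑ᶠ η : List (Fin 2), c η * wordMix d₁ d₂ η w

theorem wordMix_eq_zero (d₁ d₂ : Series A) (η w : List (Fin 2)) (h : w.length < η.length) :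
    wordMix d₁ d₂ η w = 0 := by
  induction η generalizing w with
  | nil => simp at h
  | cons x η ih =>
    have key : ∀ (d : Series A) (v : List (Fin 2)), v.length < η.length →
        (d * wordMix d₁ d₂ η) v = 0 := fun d v hv => by
      rw [(Agree.mul_left (n := v.length) (d' := 0) d
        (fun u hu => ih u (by omega))) v le_rfl, mul_zero, zero_apply]
    rcases w with _ | ⟨y, w⟩
    · fin_cases x <;> simp [wordMix, pre, add_apply]
    · have hw : w.length < η.length := by simpa using h
      fin_cases x <;> simp [wordMix, pre, add_apply, ih w hw, key _ w hw]

/-- The words of length at most `n`. -/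
def words : ℕ → Finset (List (Fin 2))
  | 0 => {[]}
  | n + 1 => insert [] ((words n).image (List.cons 0) ∪ (words n).image (List.cons 1))

theorem mem_words {n : ℕ} {w : List (Fin 2)} : w ∈ words n ↔ w.length ≤ n := by
  induction n generalizing w with
  | zero => simp [words]
  | succ n ih =>
    rcases w with _ | ⟨x, w⟩
    · simp [words]
    · fin_cases x <;> simp [words, ih]

theorem sum_words_succ (n : ℕ) (f : List (Fin 2) → A) :
    ∑ η ∈ words (n + 1), f η
      = f [] + (∑ η ∈ words n, f (0 :: η) + ∑ η ∈ words n, f (1 :: η)) := by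
  rw [words, Finset.sum_insert (by simp), Finset.sum_union, Finset.sum_image (by simp),
    Finset.sum_image (by simp)]
  rw [Finset.disjoint_left]
  simp

theorem mix_eq_sum (c d₁ d₂ : Series A) (n : ℕ) (w : List (Fin 2)) (h : w.length ≤ n) :
    mix c d₁ d₂ w = ∑ η ∈ words n, c η * wordMix d₁ d₂ η w := by
  refine finsum_eq_sum_of_support_subset _ fun η hη => ?_
  rw [Finset.mem_coe, mem_words]
  by_contra hlt
  exact hη (by simp only [wordMix_eq_zero d₁ d₂ η w (by omega), mul_zero])

theorem mul_mix (e c d₁ d₂ : Series A) (n : ℕ) (w : List (Fin 2)) (h : w.length ≤ n) :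
    (e * mix c d₁ d₂) w = ∑ η ∈ words n, c η * (e * wordMix d₁ d₂ η) w := by
  have : Agree n (mix c d₁ d₂) (∑ η ∈ words n, c η • wordMix d₁ d₂ η) := fun v hv => by
    rw [mix_eq_sum c d₁ d₂ n v hv, sum_apply]; rfl
  rw [(this.mul_left e) w h, Finset.mul_sum, sum_apply]
  exact Finset.sum_congr rfl fun η _ => by rw [shuffle_smul, smul_apply]

theorem mix_nil (c d₁ d₂ : Series A) : mix c d₁ d₂ [] = c [] := by
  rw [mix_eq_sum c d₁ d₂ 0 [] (by simp)]
  simp [words, wordMix, one_nil]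

theorem strip_one_mix (c d₁ d₂ : Series A) :
    strip 1 (mix c d₁ d₂) = d₁ * mix (strip 1 c) d₁ d₂ := by
  ext w
  rw [strip_apply, mix_eq_sum c d₁ d₂ (w.length + 1) _ (by simp), sum_words_succ,
    mul_mix _ _ _ _ w.length w le_rfl]
  simp [wordMix, pre, add_apply, one_cons, strip_apply]

theorem strip_zero_mix (c d₁ d₂ : Series A) :
    strip 0 (mix c d₁ d₂) = mix (strip 0 c) d₁ d₂ + d₂ * mix (strip 1 c) d₁ d₂ := by
  ext w
  rw [strip_apply, mix_eq_sum c d₁ d₂ (w.length + 1) _ (by simp), sum_words_succ, add_apply,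
    mul_mix _ _ _ _ w.length w le_rfl, mix_eq_sum _ _ _ w.length w le_rfl]
  simp [wordMix, pre, add_apply, one_cons, strip_apply]

theorem add_mix (c c' d₁ d₂ : Series A) :
    mix (c + c') d₁ d₂ = mix c d₁ d₂ + mix c' d₁ d₂ := by
  ext w
  simp only [add_apply, mix_eq_sum _ d₁ d₂ w.length w le_rfl, add_mul, Finset.sum_add_distrib]

theorem mul_mix_distrib (c c' d₁ d₂ : Series A) :
    mix (c * c') d₁ d₂ = mix c d₁ d₂ * mix c' d₁ d₂ := by
  refine eq_of_agree fun n => ?_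
  induction n generalizing c c' with
  | zero =>
    intro w hw
    obtain rfl : w = [] := by simpa using hw
    simp only [mul_nil, mix_nil]
  | succ n ih =>
    refine Agree.succ (by simp only [mul_nil, mix_nil]) ?_ ?_
    · rw [strip_zero_mix, strip_mul, strip_mul, strip_mul, strip_zero_mix, strip_zero_mix,
        add_mix, add_mix]
      have := ((ih (strip 0 c) c').add (ih c (strip 0 c'))).add
        (((ih (strip 1 c) c').add (ih c (strip 1 c'))).mul_left d₂)
      intro w hw
      rw [this w hw]
      refine congrFun (?_ : (_ : Series A) = _) w
      ring
    · rw [strip_one_mix, strip_mul, strip_mul, strip_one_mix, strip_one_mix, add_mix]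
      have := ((ih (strip 1 c) c').add (ih c (strip 1 c'))).mul_left d₁
      intro w hw
      rw [this w hw]
      refine congrFun (?_ : (_ : Series A) = _) w
      ring

theorem mix_mix (c d₁ d₂ h₁ h₂ : Series A) :
    mix (mix c d₁ d₂) h₁ h₂
      = mix c (mix d₁ h₁ h₂ * h₁) (mix d₂ h₁ h₂ + mix d₁ h₁ h₂ * h₂) := by
  refine eq_of_agree fun n => ?_
  induction n generalizing c with
  | zero =>
    intro w hw
    obtain rfl : w = [] := by simpa using hw
    simp only [mix_nil]
  | succ n ih =>
    refine Agree.succ (by simp only [mix_nil]) ?_ ?_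
    · rw [strip_zero_mix, strip_zero_mix, strip_zero_mix, strip_one_mix, add_mix,
        mul_mix_distrib, mul_mix_distrib]
      have := (ih (strip 0 c)).add
        ((ih (strip 1 c)).mul_left (mix d₂ h₁ h₂ + mix d₁ h₁ h₂ * h₂))
      intro w hw
      rw [← this w hw]
      refine congrFun (?_ : (_ : Series A) = _) w
      ring
    · rw [strip_one_mix, strip_one_mix, strip_one_mix, mul_mix_distrib]
      have := (ih (strip 1 c)).mul_left (mix d₁ h₁ h₂ * h₁)
      intro w hw
      rw [← this w hw]
      refine congrFun (?_ : (_ : Series A) = _) w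
      ring

theorem mix_injective {d₁ : Series A} (hd : d₁ [] = 1) (d₂ : Series A) :
    Function.Injective fun c => mix c d₁ d₂ := by
  have cancel : ∀ {a b : Series A}, d₁ * a = d₁ * b → a = b := fun {a b} h => by
    have h2 := congrArg (fun s => inv d₁ * s) h
    simpa only [← mul_assoc, mul_comm (inv d₁) d₁, mul_inv hd, one_mul] using h2
  intro c c' h
  ext w
  induction w generalizing c c' with
  | nil => have := congrFun h []; simpa only [mix_nil] using this
  | cons x w ih =>
    have h1 : mix (strip 1 c) d₁ d₂ = mix (strip 1 c') d₁ d₂ := by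
      have := congrArg (strip 1) h
      simp only [strip_one_mix] at this
      exact cancel this
    have h0 : mix (strip 0 c) d₁ d₂ = mix (strip 0 c') d₁ d₂ := by
      have := congrArg (strip 0) h
      simp only [strip_zero_mix, h1] at this
      exact add_right_cancel this
    fin_cases x
    · exact ih h0
    · exact ih h1

theorem mix_surjective {d₁ : Series A} (hd : d₁ [] = 1) (d₂ : Series A) :
    Function.Surjective fun c => mix c d₁ d₂ := by
  let unmix : Series A → Series A := fun y w => List.rec (motive := fun _ => Series A → A)
    (fun y => y [])
    (fun x _ f y => if x = 0 then f (strip 0 y - d₂ * (inv d₁ * strip 1 y))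
      else f (inv d₁ * strip 1 y)) w y
  have hs1 : ∀ y, strip 1 (unmix y) = unmix (inv d₁ * strip 1 y) := fun y => rfl
  have hs0 : ∀ y, strip 0 (unmix y) = unmix (strip 0 y - d₂ * (inv d₁ * strip 1 y)) :=
    fun y => rfl
  intro y
  refine ⟨unmix y, eq_of_agree fun n => ?_⟩
  induction n generalizing y with
  | zero =>
    intro w hw
    obtain rfl : w = [] := by simpa using hw
    simp only [mix_nil]
    rfl
  | succ n ih =>
    refine Agree.succ (by simp only [mix_nil]; rfl) ?_ ?_
    · simp only [strip_zero_mix, hs0, hs1]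
      intro w hw
      rw [((ih _).add ((ih _).mul_left d₂)) w hw]
      refine congrFun (?_ : (_ : Series A) = _) w
      ring
    · simp only [strip_one_mix, hs1]
      intro w hw
      rw [((ih _).mul_left d₁) w hw, ← mul_assoc, mul_inv hd, one_mul]

end Ring

end Series

/-- A (right) post-group. -/
class PostGroup (G : Type*) extends Group G where
  tri : G → G → G
  mul_tri : ∀ a b c : G, tri (b * c) a = tri b a * tri c a
  tri_bijective : ∀ a : G, Function.Bijective fun b => tri b a
  tri_tri : ∀ a b c : G, tri (tri c b) a = tri c (tri b a * a)

/-- The Grossman--Larson group of a post-group: the same elements with `b ⋆ a = (b ◁ a) · a`. -/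
@[ext] structure GrossmanLarson (G : Type*) where
  val : G

section GrossmanLarson

variable {G : Type*} [PostGroup G]

theorem PostGroup.one_tri (a : G) : PostGroup.tri 1 a = 1 := by
  have h := PostGroup.mul_tri a 1 1
  rw [one_mul] at h
  exact left_eq_mul.mp h

instance : Mul (GrossmanLarson G) := ⟨fun b a => ⟨PostGroup.tri b.val a.val * a.val⟩⟩

instance : One (GrossmanLarson G) := ⟨⟨1⟩⟩

noncomputable instance : Inv (GrossmanLarson G) :=
  ⟨fun a => ⟨Function.surjInv (PostGroup.tri_bijective a.val).surjective a.val⁻¹⟩⟩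

noncomputable instance : Group (GrossmanLarson G) :=
  Group.ofLeftAxioms
    (fun c b a => GrossmanLarson.ext (by
      change PostGroup.tri (PostGroup.tri c.val b.val * b.val) a.val * a.val
        = PostGroup.tri c.val (PostGroup.tri b.val a.val * a.val)
          * (PostGroup.tri b.val a.val * a.val)
      rw [PostGroup.mul_tri, PostGroup.tri_tri, mul_assoc]))
    (fun a => GrossmanLarson.ext (by
      change PostGroup.tri 1 a.val * a.val = a.val
      rw [PostGroup.one_tri, one_mul]))
    (fun a => GrossmanLarson.ext (by
      change PostGroup.tri
        (Function.surjInv (PostGroup.tri_bijective a.val).surjective a.val⁻¹) a.val * a.val = 1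
      have := Function.surjInv_eq (PostGroup.tri_bijective a.val).surjective a.val⁻¹
      rw [this, inv_mul_cancel]))

end GrossmanLarson

/-- The set `G(A)` of pairs `c = c₁ e₁ + c₂ e₂` of series with coefficients in `A` and with
`c₁(1) = 1`. -/
@[ext] structure FeedbackPair (A : Type*) [CommRing A] where
  fst : Series A
  snd : Series A
  fst_nil : fst [] = 1

namespace FeedbackPair

variable {A : Type*} [CommRing A]

open Series

/-- The product `c · d = (c₁ ⧢ d₁) e₁ + (c₂ + c₁ ⧢ d₂) e₂`. -/
instance : Mul (FeedbackPair A) :=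
  ⟨fun c d => ⟨c.fst * d.fst, c.snd + c.fst * d.snd, by rw [mul_nil, c.fst_nil, d.fst_nil, one_mul]⟩⟩

instance : One (FeedbackPair A) := ⟨⟨1, 0, one_nil⟩⟩

instance : Inv (FeedbackPair A) :=
  ⟨fun c => ⟨Series.inv c.fst, -(Series.inv c.fst * c.snd), inv_nil⟩⟩

/-- The product `c ◁ d`, the mixed composition with `d` in each component. -/
noncomputable def act (c d : FeedbackPair A) : FeedbackPair A :=
  ⟨mix c.fst d.fst d.snd, mix c.snd d.fst d.snd, by rw [mix_nil, c.fst_nil]⟩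

instance : Group (FeedbackPair A) :=
  Group.ofLeftAxioms
    (fun c d z => FeedbackPair.ext
      (mul_assoc c.fst d.fst z.fst)
      (by
        change c.snd + c.fst * d.snd + c.fst * d.fst * z.snd
          = c.snd + c.fst * (d.snd + d.fst * z.snd)
        ring))
    (fun c => FeedbackPair.ext (one_mul c.fst)
      (by change 0 + 1 * c.snd = c.snd; ring))
    (fun c => FeedbackPair.ext
      (by
        change Series.inv c.fst * c.fst = 1
        rw [mul_comm, mul_inv c.fst_nil])
      (by
        change -(Series.inv c.fst * c.snd) + Series.inv c.fst * c.snd = 0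
        ring))

noncomputable instance : PostGroup (FeedbackPair A) where
  tri := act
  mul_tri a b c := FeedbackPair.ext (mul_mix_distrib _ _ _ _)
    ((add_mix _ _ _ _).trans (congrArg _ (mul_mix_distrib _ _ _ _)))
  tri_bijective a := by
    constructor
    · intro b c h
      exact FeedbackPair.ext (mix_injective a.fst_nil a.snd (congrArg FeedbackPair.fst h))
        (mix_injective a.fst_nil a.snd (congrArg FeedbackPair.snd h))
    · intro y
      obtain ⟨b₁, h₁⟩ := mix_surjective a.fst_nil a.snd y.fst
      obtain ⟨b₂, h₂⟩ := mix_surjective a.fst_nil a.snd y.snd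
      refine ⟨⟨b₁, b₂, ?_⟩, FeedbackPair.ext h₁ h₂⟩
      have := congrFun h₁ []
      simp only [mix_nil] at this
      rw [this, y.fst_nil]
  tri_tri a b c := FeedbackPair.ext (mix_mix _ _ _ _ _) (mix_mix _ _ _ _ _)

end FeedbackPair

/-- The affine feedback group `(G(A), ⋆)`, with `c ⋆ d = (c ◁ d) · d`. -/
abbrev AffineFeedbackGroup (A : Type*) [CommRing A] : Type _ := GrossmanLarson (FeedbackPair A)

/-- An element of `G(A)`, regarded as an element of the group `(G(A), ⋆)`. -/
def toFeedback {A : Type*} [CommRing A] (c : FeedbackPair A) : AffineFeedbackGroup A := ⟨c⟩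

section LieAlgebra

open scoped commutatorElement

variable (K : Type*) [Field K]

/-- The tangent space of `G` at the identity: the pairs `u₁ e₁ + u₂ e₂` with `u₁(1) = 0`. -/
def Tangent : Submodule K (Series K × Series K) where
  carrier := {u | u.1 [] = 0}
  add_mem' {u v} hu hv := by
    change u.1 [] + v.1 [] = 0
    rw [show u.1 [] = 0 from hu, show v.1 [] = 0 from hv, add_zero]
  zero_mem' := rfl
  smul_mem' r u hu := by
    change r * u.1 [] = 0
    rw [show u.1 [] = 0 from hu, mul_zero]

/-- The ring `K[ε₁, ε₂]` with `ε₁² = ε₂² = 0`. -/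
abbrev TwoDual : Type _ := DualNumber (DualNumber K)

variable {K}

def eps₁ : TwoDual K := TrivSqZeroExt.inl DualNumber.eps

def eps₂ : TwoDual K := DualNumber.eps

/-- The element `e + r u` of `G(A)`, for `r` in a commutative `K`-algebra `A` and a tangent
vector `u`. -/
def infinitesimal {A : Type*} [CommRing A] [Algebra K A] (r : A) (u : Tangent K) :
    FeedbackPair A where
  fst := fun w => (1 : Series A) w + r * algebraMap K A (u.1.1 w)
  snd := fun w => r * algebraMap K A (u.1.2 w)
  fst_nil := by rw [show u.1.1 [] = 0 from u.2, map_zero, mul_zero, add_zero, Series.one_nil]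

/-- `Tangent K` is the kernel of `G(K[ε]) → G(K)`. -/
theorem existsUnique_infinitesimal (c : FeedbackPair (DualNumber K))
    (h₁ : ∀ w, (c.fst w).fst = (1 : Series K) w) (h₂ : ∀ w, (c.snd w).fst = 0) :
    ∃! u : Tangent K, c = infinitesimal (DualNumber.eps : DualNumber K) u := by
  have hone : ∀ w, (1 : Series (DualNumber K)) w = TrivSqZeroExt.inl ((1 : Series K) w) := by
    rintro (_ | ⟨x, w⟩) <;> rfl
  refine ⟨⟨(fun w => (c.fst w).snd, fun w => (c.snd w).snd), ?_⟩, ?_, ?_⟩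
  · change (c.fst []).snd = 0
    rw [c.fst_nil]
    rfl
  · ext w <;> simp [infinitesimal, hone, h₁, h₂, TrivSqZeroExt.algebraMap_eq_inl]
  · rintro u rfl
    ext w <;> simp [infinitesimal, hone, TrivSqZeroExt.algebraMap_eq_inl]

/-- The coefficient of `ε₁ε₂` of an element of `G(K[ε₁, ε₂])`. -/
def mixedPart (c : FeedbackPair (TwoDual K)) : Tangent K :=
  ⟨(fun w => (c.fst w).snd.snd, fun w => (c.snd w).snd.snd), by
    change (c.fst []).snd.snd = 0
    rw [c.fst_nil]
    rfl⟩

/-- The Lie bracket of the group `(G, ·)`: the coefficient of `ε₁ε₂` in the group commutator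
of `e + ε₁u` and `e + ε₂v`. -/
def bracket (u v : Tangent K) : Tangent K :=
  mixedPart ⁅infinitesimal (eps₁ : TwoDual K) u, infinitesimal (eps₂ : TwoDual K) v⁆

/-- The differential `u ↶ v` of the action `◁`: the coefficient of `ε₁ε₂` in
`(e + ε₁u) ◁ (e + ε₂v)`. -/
noncomputable def curve (u v : Tangent K) : Tangent K :=
  mixedPart (PostGroup.tri (infinitesimal (eps₁ : TwoDual K) u) (infinitesimal (eps₂ : TwoDual K) v))

/-- The Lie bracket of the affine feedback group `(G, ⋆)`: the coefficient of `ε₁ε₂` in the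
`⋆`-commutator of `e + ε₁u` and `e + ε₂v`. -/
noncomputable def feedbackBracket (u v : Tangent K) : Tangent K :=
  mixedPart ⁅toFeedback (infinitesimal (eps₁ : TwoDual K) u),
    toFeedback (infinitesimal (eps₂ : TwoDual K) v)⁆.val

/-- The derived bracket `⟦u, v⟧ = u ↶ v - v ↶ u + [u, v]`. -/
noncomputable def derivedBracket (u v : Tangent K) : Tangent K :=
  curve u v - curve v u + bracket u v

end LieAlgebra

/-- A map `V × V → V` is bilinear over `K`. -/
structure IsBilinear (K : Type*) {V : Type*} [Field K] [AddCommGroup V] [Module K V]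
    (m : V → V → V) : Prop where
  add_left : ∀ x y z, m (x + y) z = m x z + m y z
  smul_left : ∀ (r : K) (x y), m (r • x) y = r • m x y
  add_right : ∀ x y z, m x (y + z) = m x y + m x z
  smul_right : ∀ (r : K) (x y), m x (r • y) = r • m x y

/-- `br` makes the vector space `V` a Lie algebra over `K`. -/
structure IsLieBracket (K : Type*) {V : Type*} [Field K] [AddCommGroup V] [Module K V]
    (br : V → V → V) : Prop extends IsBilinear K br where
  self : ∀ x, br x x = 0
  jacobi : ∀ x y z, br x (br y z) = br (br x y) z + br y (br x z)

/-- Mathlib's Lie ring given by a Lie bracket. -/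
abbrev IsLieBracket.lieRing {K V : Type*} [Field K] [AddCommGroup V] [Module K V]
    {br : V → V → V} (h : IsLieBracket K br) : LieRing V where
  bracket := br
  add_lie := h.add_left
  lie_add := h.add_right
  lie_self := h.self
  leibniz_lie := h.jacobi

/-- Mathlib's Lie algebra given by a Lie bracket. -/
abbrev IsLieBracket.lieAlgebra {K V : Type*} [Field K] [AddCommGroup V] [Module K V]
    {br : V → V → V} (h : IsLieBracket K br) : @LieAlgebra K V _ h.lieRing :=
  @LieAlgebra.mk K V _ h.lieRing _ h.smul_right

/-- `(V, br, tri)` is a (right) post-Lie algebra over `K`. -/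
structure IsPostLie (K : Type*) {V : Type*} [Field K] [AddCommGroup V] [Module K V]
    (br tri : V → V → V) : Prop where
  lie : IsLieBracket K br
  bilinear : IsBilinear K tri
  br_tri : ∀ x y z, tri (br x y) z = br (tri x z) y + br x (tri y z)
  tri_br : ∀ x y z, tri z (br x y)
    = (tri (tri z x) y - tri z (tri x y)) - (tri (tri z y) x - tri z (tri y x))

/-- The pair `η e_i`; the indices `0, 1 : Fin 2` stand for `e₁, e₂`. -/
def basisPair {K : Type*} [Field K] (η : Series K) (i : Fin 2) : Series K × Series K :=
  if i = 0 then (η, 0) else (0, η)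

end AffineFeedback

open AffineFeedback

open scoped commutatorElement

/-! To first order, mixed composition is a derivation: `c ◁ (1 + εv₁, εv₂) = c + ε D_v c`, where
`D_v = mixDeriv v₁ v₂` is determined by its commutators with the letter-removing operators, `[strip
0, D_v] = v₂ ⧢ strip 1` and `[strip 1, D_v] = v₁ ⧢ strip 1`, together with `D_v c (∅) = 0`. Hence `u
↶ v` is `D_v` applied to both components of `u`, while a direct computation gives `[u, v] = (0, u₁ ⧢
v₂ - v₁ ⧢ u₂)`.

With these closed formulas the first post-Lie axiom is the Leibniz rule for `D_z` (`mixDeriv_mul`).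
The second says that `[D_y, D_x]`, corrected by the derivations of `x ↶ y` and `y ↶ x`, is
`D_{[x,y]}` (`mixDeriv_commutator`). Any post-Lie algebra has a derived Lie bracket
(`IsPostLie.isLieBracket_derived`).

For the group `(G, ⋆)`, the relation `a ⋆ b = c ⋆ (b ⋆ a)` characterizes the commutator `c` of `a`
and `b`, so no `⋆`-inverse is ever computed. Both sides are expanded with `scalar_mul_mix_eq`, the
first-order formula for `◁`, and compared modulo `ε₁²` and `ε₂²`. -/

namespace AffineFeedback

namespace Series

/-! ### Scalars and change of coefficients in the shuffle algebra -/

section Ring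

variable {A : Type*} [CommRing A]

instance : Algebra A (Series A) :=
  Algebra.ofModule
    (fun r c d => by rw [mul_comm, shuffle_smul, mul_comm])
    (fun r c d => shuffle_smul r c d)

/-- A ring homomorphism applied to the coefficients of a series. -/
def mapCoeff {B : Type*} [CommRing B] (f : A →+* B) (c : Series A) : Series B := fun w => f (c w)

theorem mapCoeff_mul {B : Type*} [CommRing B] (f : A →+* B) (c d : Series A) :
    mapCoeff f (c * d) = mapCoeff f c * mapCoeff f d := by
  ext w
  change f ((c * d) w) = (mapCoeff f c * mapCoeff f d) w
  induction w generalizing c d with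
  | nil => exact map_mul f _ _
  | cons x w ih => rw [mul_cons, mul_cons, map_add, ih, ih]; rfl

/-- The ring homomorphism `mapCoeff f` for the shuffle products. -/
def map {B : Type*} [CommRing B] (f : A →+* B) : Series A →+* Series B where
  toFun := mapCoeff f
  map_zero' := by ext w; exact map_zero f
  map_one' := by
    ext w
    rcases w with _ | ⟨x, w⟩
    · exact map_one f
    · exact map_zero f
  map_add' c d := by ext w; exact map_add f _ _
  map_mul' := mapCoeff_mul f

theorem map_apply {B : Type*} [CommRing B] (f : A →+* B) (c : Series A) (w : List (Fin 2)) :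
    map f c w = f (c w) := rfl

theorem strip_map {B : Type*} [CommRing B] (f : A →+* B) (x : Fin 2) (c : Series A) :
    strip x (map f c) = map f (strip x c) := rfl

/-- The scalar multiples of the empty word. -/
def scalar : A →+* Series A := algebraMap A (Series A)

/-- Extension of scalars. -/
def extend {K : Type*} [CommRing K] (A : Type*) [CommRing A] [Algebra K A] :
    Series K →+* Series A := map (algebraMap K A)

theorem extend_apply {K : Type*} [CommRing K] [Algebra K A] (c : Series K) (w : List (Fin 2)) :
    extend A c w = algebraMap K A (c w) := rfl

/-- With scalars viewed as elements of the shuffle ring, computations with nilpotent parameters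
become identities in one commutative ring, within reach of `ring` and `linear_combination`. -/
theorem smul_eq_scalar_mul (r : A) (c : Series A) : r • c = scalar r * c := Algebra.smul_def r c

theorem scalar_mul_apply (r : A) (c : Series A) (w : List (Fin 2)) :
    (scalar r * c) w = r * c w := by
  rw [← smul_eq_scalar_mul, smul_apply]

theorem strip_scalar_mul (x : Fin 2) (r : A) (c : Series A) :
    strip x (scalar r * c) = scalar r * strip x c := by
  rw [← smul_eq_scalar_mul, ← smul_eq_scalar_mul, strip_smul]

/-! ### The derivations of the shuffle algebra that linearize mixed composition -/

/-- The derivative of `c ◁ (1 + ε v₁, ε v₂)` with respect to `ε`. -/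
def mixDeriv (v₁ v₂ : Series A) (c : Series A) : Series A
  | [] => 0
  | x :: w => mixDeriv v₁ v₂ (strip x c) w + ((if x = 0 then v₂ else v₁) * strip 1 c) w

theorem mixDeriv_nil (v₁ v₂ c : Series A) : mixDeriv v₁ v₂ c [] = 0 := rfl

theorem strip_zero_mixDeriv (v₁ v₂ c : Series A) :
    strip 0 (mixDeriv v₁ v₂ c) = mixDeriv v₁ v₂ (strip 0 c) + v₂ * strip 1 c := rfl

theorem strip_one_mixDeriv (v₁ v₂ c : Series A) :
    strip 1 (mixDeriv v₁ v₂ c) = mixDeriv v₁ v₂ (strip 1 c) + v₁ * strip 1 c := rfl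

theorem strip_mixDeriv (v₁ v₂ c : Series A) (x : Fin 2) :
    strip x (mixDeriv v₁ v₂ c)
      = mixDeriv v₁ v₂ (strip x c) + (if x = 0 then v₂ else v₁) * strip 1 c := rfl

theorem mixDeriv_add (v₁ v₂ c d : Series A) :
    mixDeriv v₁ v₂ (c + d) = mixDeriv v₁ v₂ c + mixDeriv v₁ v₂ d := by
  ext w
  induction w generalizing c d with
  | nil => exact (add_zero (0 : A)).symm
  | cons x w ih =>
    rw [add_apply]
    simp only [← strip_apply, strip_mixDeriv, strip_add, add_apply, ih, mul_add]
    ring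

theorem mixDeriv_smul (v₁ v₂ : Series A) (r : A) (c : Series A) :
    mixDeriv v₁ v₂ (r • c) = r • mixDeriv v₁ v₂ c := by
  ext w
  induction w generalizing c with
  | nil => exact (mul_zero r).symm
  | cons x w ih =>
    rw [smul_apply]
    simp only [← strip_apply, strip_mixDeriv, strip_smul, add_apply, ih, shuffle_smul, smul_apply]
    ring

theorem add_mixDeriv (v₁ v₂ v₁' v₂' c : Series A) :
    mixDeriv (v₁ + v₁') (v₂ + v₂') c = mixDeriv v₁ v₂ c + mixDeriv v₁' v₂' c := by
  ext w
  induction w generalizing c with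
  | nil => exact (add_zero (0 : A)).symm
  | cons x w ih =>
    rw [add_apply]
    simp only [← strip_apply, strip_mixDeriv, add_apply, ih]
    split_ifs <;> simp only [add_mul, add_apply] <;> ring

theorem smul_mixDeriv (r : A) (v₁ v₂ c : Series A) :
    mixDeriv (r • v₁) (r • v₂) c = r • mixDeriv v₁ v₂ c := by
  ext w
  induction w generalizing c with
  | nil => exact (mul_zero r).symm
  | cons x w ih =>
    rw [smul_apply]
    simp only [← strip_apply, strip_mixDeriv, add_apply, ih, smul_apply]
    split_ifs <;> simp only [smul_mul_assoc, smul_apply] <;> ring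

theorem mixDeriv_zero (v₁ v₂ : Series A) : mixDeriv v₁ v₂ 0 = 0 := by
  simpa using mixDeriv_smul v₁ v₂ (0 : A) 0

theorem mixDeriv_neg (v₁ v₂ c : Series A) : mixDeriv v₁ v₂ (-c) = -mixDeriv v₁ v₂ c := by
  simpa using mixDeriv_smul v₁ v₂ (-1 : A) c

theorem mixDeriv_sub (v₁ v₂ c d : Series A) :
    mixDeriv v₁ v₂ (c - d) = mixDeriv v₁ v₂ c - mixDeriv v₁ v₂ d := by
  rw [sub_eq_add_neg, mixDeriv_add, mixDeriv_neg, sub_eq_add_neg]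

/-- Infinitesimal form of `mul_mix_distrib`. Since `strip x` and multiples of `strip 1` are
derivations of the shuffle product, the Leibniz defect propagates by induction on the word. -/
theorem mixDeriv_mul (v₁ v₂ c d : Series A) :
    mixDeriv v₁ v₂ (c * d) = mixDeriv v₁ v₂ c * d + c * mixDeriv v₁ v₂ d := by
  ext w
  induction w generalizing c d with
  | nil => simp [mixDeriv_nil, mul_nil, add_apply]
  | cons x w ih =>
    rw [add_apply, mul_cons, mul_cons, ← strip_apply x (mixDeriv v₁ v₂ (c * d))]
    simp only [strip_mixDeriv, strip_mul, mixDeriv_add, add_apply, ih]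
    simp only [← add_apply]
    refine congrFun (?_ : (_ : Series A) = _) w
    ring

/-- Removing a first letter from `D_y D_x c` yields, besides `D_y D_x` of the stripped series, four
terms. With `x_a`, `y_a` the entries attached to the letter `a`, two of them, `x_a ⧢ D_y (strip 1
c)` and `y_a ⧢ D_x (strip 1 c)`, are together symmetric in `x, y` and cancel. The term `D_y x_a ⧢
strip 1 c` is removed by the correction. What survives is the antisymmetrization of `y_a ⧢ x₁ ⧢
strip 1 c`: zero for the letter `x₁`, and `(x₁ y₂ - y₁ x₂) ⧢ strip 1 c` for the letter `x₀`, in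
accordance with the pair on the left. -/
theorem mixDeriv_commutator (x₁ x₂ y₁ y₂ c : Series A) :
    mixDeriv 0 (x₁ * y₂ - y₁ * x₂) c
      = (mixDeriv y₁ y₂ (mixDeriv x₁ x₂ c)
          - mixDeriv (mixDeriv y₁ y₂ x₁) (mixDeriv y₁ y₂ x₂) c)
        - (mixDeriv x₁ x₂ (mixDeriv y₁ y₂ c)
          - mixDeriv (mixDeriv x₁ x₂ y₁) (mixDeriv x₁ x₂ y₂) c) := by
  ext w
  induction w generalizing c with
  | nil => simp [mixDeriv_nil, sub_apply]
  | cons x w ih =>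
    simp only [sub_apply]
    simp only [← strip_apply x, strip_mixDeriv, if_neg (one_ne_zero (α := Fin 2)), mixDeriv_add,
      mixDeriv_mul, add_apply, ih]
    simp only [← add_apply, ← sub_apply]
    refine congrFun (?_ : (_ : Series A) = _) w
    split_ifs <;> ring

/-! ### Mixed composition to first order -/

theorem one_mix (d₁ d₂ : Series A) : mix 1 d₁ d₂ = 1 := by
  have zero_mix : mix (0 : Series A) d₁ d₂ = 0 := by
    simpa using add_mix (0 : Series A) 0 d₁ d₂
  ext w
  rcases w with _ | ⟨x, w⟩
  · exact mix_nil _ _ _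
  · rw [one_cons, ← strip_apply x (mix 1 d₁ d₂)]
    fin_cases x
    · change strip 0 (mix 1 d₁ d₂) w = 0
      rw [strip_zero_mix, strip_one, strip_one, zero_mix, mul_zero, add_zero, zero_apply]
    · change strip 1 (mix 1 d₁ d₂) w = 0
      rw [strip_one_mix, strip_one, zero_mix, mul_zero, zero_apply]

theorem scalar_mul_mix (r : A) (c d₁ d₂ : Series A) :
    mix (scalar r * c) d₁ d₂ = scalar r * mix c d₁ d₂ := by
  ext w
  rw [scalar_mul_apply, mix_eq_sum _ d₁ d₂ w.length w le_rfl,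
    mix_eq_sum _ d₁ d₂ w.length w le_rfl, Finset.mul_sum]
  exact Finset.sum_congr rfl fun η _ => by rw [scalar_mul_apply, mul_assoc]

/-- Mixed composition to first order in `ε`, multiplied by a scalar `r` that kills `ε²` and the
higher order terms of the right-hand factor. -/
theorem scalar_mul_mix_eq {r ε : A} {d₁ d₂ v₁ v₂ : Series A} (hε : ε * ε = 0)
    (h₁ : scalar r * d₁
      = scalar r * (1 + scalar ε * v₁))
    (h₂ : scalar r * d₂
      = scalar r * (scalar ε * v₂)) (c : Series A) :
    scalar r * mix c d₁ d₂
      = scalar r * (c + scalar ε * mixDeriv v₁ v₂ c) := by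
  have hE : scalar ε * scalar ε = 0 := by
    rw [← map_mul, hε, map_zero]
  generalize hR : scalar r = R at *
  refine eq_of_agree fun n => ?_
  induction n generalizing c with
  | zero =>
    intro w hw
    obtain rfl : w = [] := by simpa using hw
    simp only [mul_nil, mix_nil, add_apply, mixDeriv_nil, mul_zero, add_zero]
  | succ n ih =>
    subst hR
    refine Agree.succ ?_ ?_ ?_
    · simp only [mul_nil, mix_nil, add_apply, mixDeriv_nil, mul_zero, add_zero]
    · simp only [strip_scalar_mul, strip_add, strip_zero_mix, strip_zero_mixDeriv]
      have := (ih (strip 0 c)).add ((ih (strip 1 c)).mul_left d₂)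
      intro w hw
      refine (congrFun (?_ : (_ : Series A) = _) w).trans ((this w hw).trans
        (congrFun (?_ : (_ : Series A) = _) w))
      · ring
      -- After `h₂` replaces `d₂`, two first-order terms are multiplied; their product carries `ε²`
      -- and is removed by `hE`. The letter `x₁` is handled below in the same way with `h₁`.
      · linear_combination (strip 1 c + scalar ε * mixDeriv v₁ v₂ (strip 1 c)) * h₂
          + scalar r * v₂ * mixDeriv v₁ v₂ (strip 1 c) * hE
    · simp only [strip_scalar_mul, strip_add, strip_one_mix, strip_one_mixDeriv]
      have := (ih (strip 1 c)).mul_left d₁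
      intro w hw
      refine (congrFun (?_ : (_ : Series A) = _) w).trans ((this w hw).trans
        (congrFun (?_ : (_ : Series A) = _) w))
      · ring
      · linear_combination (strip 1 c + scalar ε * mixDeriv v₁ v₂ (strip 1 c)) * h₁
          + scalar r * v₁ * mixDeriv v₁ v₂ (strip 1 c) * hE

/-- The recursion uses only sums and shuffle products, which any coefficient homomorphism respects.
This brings derivatives computed over `K[ε₁, ε₂]` back to series over `K`. -/
theorem mixDeriv_map {B : Type*} [CommRing B] (f : A →+* B) (v₁ v₂ c : Series A) :
    mixDeriv (map f v₁) (map f v₂) (map f c) = map f (mixDeriv v₁ v₂ c) := by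
  ext w
  rw [map_apply]
  induction w generalizing c with
  | nil => exact (map_zero f).symm
  | cons x w ih =>
    rw [← strip_apply x (mixDeriv (map f v₁) (map f v₂) (map f c)),
      ← strip_apply x (mixDeriv v₁ v₂ c), strip_mixDeriv, strip_mixDeriv, add_apply, add_apply,
      map_add, strip_map, strip_map, ih]
    congr 1
    rw [← map_apply f (_ * _) w, RingHom.map_mul]
    split_ifs <;> rfl

theorem mixDeriv_extend {B : Type*} [CommRing B] [Algebra A B] (v₁ v₂ c : Series A) :
    mixDeriv (extend B v₁) (extend B v₂) (extend B c) = extend B (mixDeriv v₁ v₂ c) :=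
  mixDeriv_map _ _ _ _

end Ring

end Series

/-! ### Bracket and action on the tangent space, and the post-Lie axioms -/

section LieAlgebra

open Series
open scoped commutatorElement

variable {K : Type*} [Field K]

theorem eps₁_mul_self : (eps₁ : TwoDual K) * eps₁ = 0 := by
  rw [eps₁, ← TrivSqZeroExt.inl_mul, DualNumber.eps_mul_eps, TrivSqZeroExt.inl_zero]

theorem eps₂_mul_self : (eps₂ : TwoDual K) * eps₂ = 0 := DualNumber.eps_mul_eps

theorem eps₁_mul_eps₂_mul_algebraMap_snd_snd (a : K) :
    ((eps₁ * eps₂ : TwoDual K) * algebraMap K (TwoDual K) a).snd.snd = a := by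
  simp [eps₁, eps₂, TrivSqZeroExt.algebraMap_eq_inl']

theorem infinitesimal_fst {A : Type*} [CommRing A] [Algebra K A] (r : A) (u : Tangent K) :
    (infinitesimal r u).fst
      = 1 + scalar r * extend A u.1.1 := by
  ext w
  rw [Series.add_apply, scalar_mul_apply]
  rfl

theorem infinitesimal_snd {A : Type*} [CommRing A] [Algebra K A] (r : A) (u : Tangent K) :
    (infinitesimal r u).snd = scalar r * extend A u.1.2 := by
  ext w
  rw [scalar_mul_apply]
  rfl

theorem mixedPart_infinitesimal (u : Tangent K) :
    mixedPart (infinitesimal (eps₁ * eps₂ : TwoDual K) u) = u := by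
  have hone : ∀ w, ((1 : Series (TwoDual K)) w).snd.snd = 0 := by
    rintro (_ | ⟨x, w⟩) <;> rfl
  refine Subtype.ext (Prod.ext (Series.ext fun w => ?_) (Series.ext fun w => ?_))
  · change ((1 : Series (TwoDual K)) w
      + eps₁ * eps₂ * algebraMap K (TwoDual K) (u.1.1 w)).snd.snd = u.1.1 w
    rw [TrivSqZeroExt.snd_add, TrivSqZeroExt.snd_add, hone,
      eps₁_mul_eps₂_mul_algebraMap_snd_snd, zero_add]
  · exact eps₁_mul_eps₂_mul_algebraMap_snd_snd _

/-- The formula `(0, u₁ ⧢ v₂ - v₁ ⧢ u₂)` for the Lie bracket of `(G, ·)`. -/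
def shuffleBracket (u v : Tangent K) : Tangent K := ⟨(0, u.1.1 * v.1.2 - v.1.1 * u.1.2), rfl⟩

/-- The derivation `mixDeriv v₁ v₂` applied to both components. -/
def pairDeriv (u v : Tangent K) : Tangent K :=
  ⟨(mixDeriv v.1.1 v.1.2 u.1.1, mixDeriv v.1.1 v.1.2 u.1.2), rfl⟩

theorem commutator_infinitesimal (u v : Tangent K) :
    ⁅infinitesimal (eps₁ : TwoDual K) u, infinitesimal (eps₂ : TwoDual K) v⁆
      = infinitesimal (eps₁ * eps₂ : TwoDual K) (shuffleBracket u v) := by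
  -- The claim becomes `a b = c b a`, free of inverses. Both components are then polynomial
  -- identities in `ε₁` and `ε₂`, exact without discarding squares.
  rw [commutatorElement_def, mul_inv_eq_iff_eq_mul, mul_inv_eq_iff_eq_mul]
  refine FeedbackPair.ext ?_ ?_
  · change (infinitesimal _ _).fst * (infinitesimal _ _).fst
      = (infinitesimal _ _).fst * (infinitesimal _ _).fst * (infinitesimal _ _).fst
    simp only [infinitesimal_fst, shuffleBracket, map_zero]
    ring
  · change (infinitesimal _ _).snd + (infinitesimal _ _).fst * (infinitesimal _ _).snd
      = ((infinitesimal _ _).snd + (infinitesimal _ _).fst * (infinitesimal _ _).snd)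
        + (infinitesimal _ _).fst * (infinitesimal _ _).fst * (infinitesimal _ _).snd
    simp only [infinitesimal_fst, infinitesimal_snd, shuffleBracket, map_zero, map_sub, map_mul]
    ring

theorem bracket_eq (u v : Tangent K) : bracket u v = shuffleBracket u v := by
  rw [bracket, commutator_infinitesimal, mixedPart_infinitesimal]

/-- As `◁` fixes the empty word and is linear on the left, everything beyond the identity carries
the factor `r`, and only the right factor has to be expanded to first order. -/
theorem tri_infinitesimal {A : Type*} [CommRing A] [Algebra K A] (r s : A) (hs : s * s = 0)
    (u v : Tangent K) :
    (PostGroup.tri (infinitesimal r u) (infinitesimal s v)).fst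
        = 1 + scalar r * (extend A u.1.1
          + scalar s * extend A (pairDeriv u v).1.1) ∧
      (PostGroup.tri (infinitesimal r u) (infinitesimal s v)).snd
        = scalar r * (extend A u.1.2
          + scalar s * extend A (pairDeriv u v).1.2) := by
  have key := scalar_mul_mix_eq (r := r) hs
    (congrArg (scalar r * ·) (infinitesimal_fst s v))
    (congrArg (scalar r * ·) (infinitesimal_snd s v))
  constructor
  · change mix (infinitesimal r u).fst (infinitesimal s v).fst (infinitesimal s v).snd = _
    rw [infinitesimal_fst r u, add_mix, one_mix, scalar_mul_mix, key, mixDeriv_extend]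
    rfl
  · change mix (infinitesimal r u).snd (infinitesimal s v).fst (infinitesimal s v).snd = _
    rw [infinitesimal_snd r u, scalar_mul_mix, key, mixDeriv_extend]
    rfl

/-- The additive correction `rs(u ↶ v)` may be written as a factor in `(G, ·)`, because the cross
terms of that product contain `r²`. -/
theorem tri_infinitesimal_eq {A : Type*} [CommRing A] [Algebra K A] {r s : A} (hr : r * r = 0)
    (hs : s * s = 0) (u v : Tangent K) :
    PostGroup.tri (infinitesimal r u) (infinitesimal s v)
      = infinitesimal r u * infinitesimal (r * s) (pairDeriv u v) := by
  obtain ⟨h₁, h₂⟩ := tri_infinitesimal r s hs u v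
  have hR : scalar r * scalar r = 0 := by
    rw [← map_mul, hr, map_zero]
  refine FeedbackPair.ext ?_ ?_
  · rw [h₁]
    change _ = (infinitesimal _ _).fst * (infinitesimal _ _).fst
    rw [infinitesimal_fst, infinitesimal_fst, map_mul]
    linear_combination (-(extend A u.1.1 * scalar s
      * extend A (pairDeriv u v).1.1)) * hR
  · rw [h₂]
    change _ = (infinitesimal _ _).snd + (infinitesimal _ _).fst * (infinitesimal _ _).snd
    rw [infinitesimal_fst, infinitesimal_snd, infinitesimal_snd, map_mul]
    linear_combination (-(extend A u.1.1 * scalar s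
      * extend A (pairDeriv u v).1.2)) * hR

theorem curve_eq (u v : Tangent K) : curve u v = pairDeriv u v := by
  obtain ⟨h₁, h₂⟩ := tri_infinitesimal (eps₁ : TwoDual K) eps₂ eps₂_mul_self u v
  have hone : ∀ w, ((1 : Series (TwoDual K)) w).snd.snd = 0 := by
    rintro (_ | ⟨x, w⟩) <;> rfl
  have hsnd : ∀ a b : K, ((eps₁ : TwoDual K) * (algebraMap K (TwoDual K) a
      + eps₂ * algebraMap K (TwoDual K) b)).snd.snd = b := fun a b => by
    simp [eps₁, eps₂, TrivSqZeroExt.algebraMap_eq_inl']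
  refine Subtype.ext (Prod.ext (Series.ext fun w => ?_) (Series.ext fun w => ?_))
  · refine (congrArg (fun c : Series (TwoDual K) => (c w).snd.snd) h₁).trans ?_
    simp only [Series.add_apply, scalar_mul_apply, extend_apply]
    rw [TrivSqZeroExt.snd_add, TrivSqZeroExt.snd_add, hone, hsnd, zero_add]
  · refine (congrArg (fun c : Series (TwoDual K) => (c w).snd.snd) h₂).trans ?_
    simp only [Series.add_apply, scalar_mul_apply, extend_apply]
    exact hsnd _ _

/-- This is a semidirect product: the abelian `e₁`-part acts on the abelian ideal of the `e₂`-part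
by shuffle multiplication. Jacobi amounts to these multiplications commuting. -/
theorem isLieBracket_shuffleBracket : IsLieBracket K (shuffleBracket (K := K)) where
  add_left x y z := Subtype.ext (Prod.ext (add_zero _).symm (by
    change (x.1.1 + y.1.1) * z.1.2 - z.1.1 * (x.1.2 + y.1.2)
      = (x.1.1 * z.1.2 - z.1.1 * x.1.2) + (y.1.1 * z.1.2 - z.1.1 * y.1.2)
    ring))
  smul_left r x y := Subtype.ext (Prod.ext (smul_zero r).symm (by
    change (r • x.1.1) * y.1.2 - y.1.1 * (r • x.1.2) = r • (x.1.1 * y.1.2 - y.1.1 * x.1.2)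
    rw [smul_mul_assoc, mul_smul_comm, smul_sub]))
  add_right x y z := Subtype.ext (Prod.ext (add_zero _).symm (by
    change x.1.1 * (y.1.2 + z.1.2) - (y.1.1 + z.1.1) * x.1.2
      = (x.1.1 * y.1.2 - y.1.1 * x.1.2) + (x.1.1 * z.1.2 - z.1.1 * x.1.2)
    ring))
  smul_right r x y := Subtype.ext (Prod.ext (smul_zero r).symm (by
    change x.1.1 * (r • y.1.2) - (r • y.1.1) * x.1.2 = r • (x.1.1 * y.1.2 - y.1.1 * x.1.2)
    rw [smul_mul_assoc, mul_smul_comm, smul_sub]))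
  self x := Subtype.ext (Prod.ext rfl (sub_self _))
  jacobi x y z := Subtype.ext (Prod.ext (add_zero _).symm (by
    change x.1.1 * (y.1.1 * z.1.2 - z.1.1 * y.1.2) - 0 * x.1.2
      = (0 * z.1.2 - z.1.1 * (x.1.1 * y.1.2 - y.1.1 * x.1.2))
        + (y.1.1 * (x.1.1 * z.1.2 - z.1.1 * x.1.2) - 0 * y.1.2)
    ring))

theorem isPostLie_shuffleBracket_pairDeriv :
    IsPostLie K (shuffleBracket (K := K)) pairDeriv where
  lie := isLieBracket_shuffleBracket
  bilinear :=
    { add_left := fun x y z => Subtype.ext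
        (Prod.ext (mixDeriv_add _ _ _ _) (mixDeriv_add _ _ _ _))
      smul_left := fun r x y => Subtype.ext
        (Prod.ext (mixDeriv_smul _ _ _ _) (mixDeriv_smul _ _ _ _))
      add_right := fun x y z => Subtype.ext
        (Prod.ext (add_mixDeriv _ _ _ _ _) (add_mixDeriv _ _ _ _ _))
      smul_right := fun r x y => Subtype.ext
        (Prod.ext (smul_mixDeriv _ _ _ _) (smul_mixDeriv _ _ _ _)) }
  br_tri x y z := Subtype.ext (Prod.ext ((mixDeriv_zero _ _).trans (add_zero _).symm) (by
    change mixDeriv z.1.1 z.1.2 (x.1.1 * y.1.2 - y.1.1 * x.1.2)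
      = (mixDeriv z.1.1 z.1.2 x.1.1 * y.1.2 - y.1.1 * mixDeriv z.1.1 z.1.2 x.1.2)
        + (x.1.1 * mixDeriv z.1.1 z.1.2 y.1.2 - mixDeriv z.1.1 z.1.2 y.1.1 * x.1.2)
    rw [mixDeriv_sub, mixDeriv_mul, mixDeriv_mul]
    ring))
  tri_br x y z := Subtype.ext
    (Prod.ext (mixDeriv_commutator _ _ _ _ _) (mixDeriv_commutator _ _ _ _ _))

end LieAlgebra

/-! ### The derived Lie bracket of an abstract post-Lie algebra -/

section PostLie

variable {K V : Type*} [Field K] [AddCommGroup V] [Module K V]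

theorem IsBilinear.sub_left {m : V → V → V} (h : IsBilinear K m) (x y z : V) :
    m (x - y) z = m x z - m y z := by
  rw [eq_sub_iff_add_eq, ← h.add_left, sub_add_cancel]

theorem IsBilinear.sub_right {m : V → V → V} (h : IsBilinear K m) (x y z : V) :
    m x (y - z) = m x y - m x z := by
  rw [eq_sub_iff_add_eq, ← h.add_right, sub_add_cancel]

theorem IsLieBracket.skew {br : V → V → V} (h : IsLieBracket K br) (x y : V) :
    br x y = -br y x := by
  have := h.self (x + y)
  rw [h.add_left, h.add_right, h.add_right, h.self, h.self, zero_add, add_zero] at this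
  exact eq_neg_of_add_eq_zero_left this

/-- The derived Lie bracket of a post-Lie algebra. -/
theorem IsPostLie.isLieBracket_derived {br tri : V → V → V} (h : IsPostLie K br tri) :
    IsLieBracket K fun x y => tri x y - tri y x + br x y where
  add_left x y z := by
    simp only [h.bilinear.add_left, h.bilinear.add_right, h.lie.add_left]; abel
  smul_left r x y := by
    simp only [h.bilinear.smul_left, h.bilinear.smul_right, h.lie.smul_left]; module
  add_right x y z := by
    simp only [h.bilinear.add_left, h.bilinear.add_right, h.lie.add_right]; abel
  smul_right r x y := by
    simp only [h.bilinear.smul_left, h.bilinear.smul_right, h.lie.smul_right]; module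
  self x := by rw [h.lie.self, sub_self, add_zero]
  jacobi x y z := by
    simp only [h.bilinear.add_left, h.bilinear.add_right, h.bilinear.sub_left,
      h.bilinear.sub_right, h.lie.add_left, h.lie.add_right, h.lie.toIsBilinear.sub_left,
      h.lie.toIsBilinear.sub_right, h.br_tri, h.tri_br, h.lie.jacobi x y z]
    -- After expansion by the post-Lie axioms and the Jacobi identity, the terms cancel up to the
    -- order of entries in brackets of an element with a product; skew-symmetry aligns them.
    rw [h.lie.skew x (tri z y), h.lie.skew y (tri z x), h.lie.skew (tri x z) y]
    abel

end PostLie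

/-! ### Commutators in the affine feedback group -/

section Feedback

open Series
open scoped commutatorElement

variable {K : Type*} [Field K]

/-- Modulo `r²` and `s²`, the products `a ⋆ b` and `b ⋆ a` differ by an `rs`-term only: the two
actions contribute `u ↶ v - v ↶ u`, the product of `(G, ·)` contributes `[u, v]`. Left
`⋆`-multiplication by `e + rs w` adds exactly `rs w`. -/
theorem commutator_toFeedback_infinitesimal {A : Type*} [CommRing A] [Algebra K A] {r s : A}
    (hr : r * r = 0) (hs : s * s = 0) (u v : Tangent K) :
    ⁅toFeedback (infinitesimal r u), toFeedback (infinitesimal s v)⁆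
      = toFeedback (infinitesimal (r * s)
          (pairDeriv u v - pairDeriv v u + shuffleBracket u v)) := by
  rw [commutatorElement_def, mul_inv_eq_iff_eq_mul, mul_inv_eq_iff_eq_mul, mul_assoc]
  set w := pairDeriv u v - pairDeriv v u + shuffleBracket u v
  have hw₁ : extend A w.1.1 = extend A (pairDeriv u v).1.1 - extend A (pairDeriv v u).1.1 := by
    rw [← map_sub]
    exact congrArg _ (add_zero _)
  have hw₂ : extend A w.1.2
      = extend A (pairDeriv u v).1.2 - extend A (pairDeriv v u).1.2
        + (extend A u.1.1 * extend A v.1.2 - extend A v.1.1 * extend A u.1.2) := by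
    rw [← map_mul, ← map_mul, ← map_sub, ← map_sub, ← map_add]
    rfl
  obtain ⟨ab₁, ab₂⟩ := tri_infinitesimal r s hs u v
  obtain ⟨ba₁, ba₂⟩ := tri_infinitesimal s r hr v u
  have hE₁ : (scalar r : Series A) * scalar r = 0 := by rw [← map_mul, hr, map_zero]
  have hE₂ : (scalar s : Series A) * scalar s = 0 := by rw [← map_mul, hs, map_zero]
  -- This is `b ⋆ a`. It differs from `e` by terms containing `r` or `s`, so multiplication by `rs`
  -- makes it indistinguishable from `e`.
  set d := PostGroup.tri (infinitesimal s v) (infinitesimal r u) * infinitesimal r u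
  have d₁ : d.fst = (1 + scalar s * (extend A v.1.1 + scalar r * extend A (pairDeriv v u).1.1))
      * (1 + scalar r * extend A u.1.1) := by
    rw [← ba₁, ← infinitesimal_fst]
    rfl
  have d₂ : d.snd = scalar s * (extend A v.1.2 + scalar r * extend A (pairDeriv v u).1.2)
      + (1 + scalar s * (extend A v.1.1 + scalar r * extend A (pairDeriv v u).1.1))
        * (scalar r * extend A u.1.2) := by
    rw [← ba₁, ← ba₂, ← infinitesimal_snd]
    rfl
  have rsd₁ : scalar r * scalar s * d.fst = scalar r * scalar s := by
    rw [d₁]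
    linear_combination scalar r * (extend A v.1.1 + scalar r * extend A (pairDeriv v u).1.1)
      * (1 + scalar r * extend A u.1.1) * hE₂ + scalar s * extend A u.1.1 * hE₁
  have rsd₂ : scalar r * scalar s * d.snd = 0 := by
    rw [d₂]
    linear_combination scalar r * (extend A v.1.2 + scalar r * extend A (pairDeriv v u).1.2) * hE₂
      + scalar s * (1 + scalar s * (extend A v.1.1 + scalar r * extend A (pairDeriv v u).1.1))
        * extend A u.1.2 * hE₁
  have key (c : Series A) :
      scalar (r * s) * mix c d.fst d.snd = scalar (r * s) * c := by
    -- The first-order formula with zero perturbation: after multiplication by `rs`, composing with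
    -- `d` is composing with the identity.
    have := scalar_mul_mix_eq (r := r * s) (ε := 0) (d₁ := d.fst) (d₂ := d.snd) (v₁ := 0) (v₂ := 0)
      (mul_zero 0) (by rw [map_mul, rsd₁, mul_zero, add_zero, mul_one])
      (by rw [map_mul, rsd₂, mul_zero, mul_zero]) c
    rwa [map_zero, zero_mul, add_zero] at this
  have cd₁ : (PostGroup.tri (infinitesimal (r * s) w) d).fst
      = 1 + scalar r * scalar s * extend A w.1.1 := by
    change mix (infinitesimal (r * s) w).fst d.fst d.snd = _
    rw [infinitesimal_fst, add_mix, one_mix, scalar_mul_mix, key, map_mul]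
  have cd₂ : (PostGroup.tri (infinitesimal (r * s) w) d).snd
      = scalar r * scalar s * extend A w.1.2 := by
    change mix (infinitesimal (r * s) w).snd d.fst d.snd = _
    rw [infinitesimal_snd, scalar_mul_mix, key, map_mul]
  refine GrossmanLarson.ext (FeedbackPair.ext ?_ ?_)
  · change (PostGroup.tri (infinitesimal r u) (infinitesimal s v)).fst * (infinitesimal s v).fst
      = (PostGroup.tri (infinitesimal (r * s) w) d).fst * d.fst
    rw [cd₁, ab₁, infinitesimal_fst, hw₁]
    set p := extend A (pairDeriv u v).1.1
    set q := extend A (pairDeriv v u).1.1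
    -- The first two terms discard the `s²` and `r²` contributions to the two products; `rsd₁`
    -- reduces `rs(p - q) d₁` to `rs(p - q)`.
    linear_combination scalar r * p * extend A v.1.1 * hE₂ - scalar s * q * extend A u.1.1 * hE₁
      - (p - q) * rsd₁ - d₁
  · change (PostGroup.tri (infinitesimal r u) (infinitesimal s v)).snd
        + (PostGroup.tri (infinitesimal r u) (infinitesimal s v)).fst * (infinitesimal s v).snd
      = (PostGroup.tri (infinitesimal (r * s) w) d).snd
        + (PostGroup.tri (infinitesimal (r * s) w) d).fst * d.snd
    rw [cd₁, cd₂, ab₁, ab₂, infinitesimal_snd, hw₁, hw₂]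
    set p := extend A (pairDeriv u v).1.1
    set q := extend A (pairDeriv v u).1.1
    linear_combination scalar r * p * extend A v.1.2 * hE₂ - scalar s * q * extend A u.1.2 * hE₁
      - (p - q) * rsd₂ - d₂

theorem derivedBracket_eq (u v : Tangent K) :
    derivedBracket u v = pairDeriv u v - pairDeriv v u + shuffleBracket u v := by
  rw [derivedBracket, curve_eq, curve_eq, bracket_eq]

end Feedback

end AffineFeedback

theorem mainTheorem9 (K : Type*) [Field K] [CharZero K] :
    -- the bracket is the Lie bracket of the group `(G, ·)`, and has the displayed values
    (∀ u v : Tangent K,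
      ⁅infinitesimal (eps₁ : TwoDual K) u, infinitesimal (eps₂ : TwoDual K) v⁆
        = infinitesimal (eps₁ * eps₂ : TwoDual K) (bracket u v)) ∧
    (∀ (i j : Fin 2) (η ζ : Series K) (hη : basisPair η i ∈ Tangent K)
      (hζ : basisPair ζ j ∈ Tangent K),
      (bracket (⟨basisPair η i, hη⟩ : Tangent K) ⟨basisPair ζ j, hζ⟩ : Series K × Series K)
        = (if i = 0 then basisPair (η * ζ) j else 0)
          - (if j = 0 then basisPair (η * ζ) i else 0)) ∧
    -- the post-Lie product is the differential of the action
    (∀ u v : Tangent K,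
      PostGroup.tri (infinitesimal (eps₁ : TwoDual K) u) (infinitesimal (eps₂ : TwoDual K) v)
        = infinitesimal (eps₁ : TwoDual K) u
          * infinitesimal (eps₁ * eps₂ : TwoDual K) (curve u v)) ∧
    -- post-Lie algebra
    IsPostLie K (bracket (K := K)) curve ∧
    -- the derived bracket is the Lie bracket of the affine feedback group `(G, ⋆)`
    IsLieBracket K (derivedBracket (K := K)) ∧
    (∀ u v : Tangent K, derivedBracket u v = feedbackBracket u v) ∧
    (∀ u v : Tangent K,
      ⁅toFeedback (infinitesimal (eps₁ : TwoDual K) u),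
          toFeedback (infinitesimal (eps₂ : TwoDual K) v)⁆
        = toFeedback (infinitesimal (eps₁ * eps₂ : TwoDual K) (derivedBracket u v))) := by

  have hbr : bracket (K := K) = shuffleBracket := funext fun u => funext fun v => bracket_eq u v
  have htri : curve (K := K) = pairDeriv := funext fun u => funext fun v => curve_eq u v
  have hpost : IsPostLie K (bracket (K := K)) curve := by
    rw [hbr, htri]
    exact isPostLie_shuffleBracket_pairDeriv
  have hcomm : ∀ u v : Tangent K,
      ⁅toFeedback (infinitesimal (eps₁ : TwoDual K) u),
          toFeedback (infinitesimal (eps₂ : TwoDual K) v)⁆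
        = toFeedback (infinitesimal (eps₁ * eps₂ : TwoDual K) (derivedBracket u v)) :=
    fun u v => by rw [commutator_toFeedback_infinitesimal eps₁_mul_self eps₂_mul_self, derivedBracket_eq]
  refine ⟨fun u v => ?_, fun i j η ζ hη hζ => ?_, fun u v => ?_, hpost,
    hpost.isLieBracket_derived, fun u v => ?_, hcomm⟩
  · rw [commutator_infinitesimal, bracket_eq]
  · rw [bracket_eq]
    -- For equal indices both sides vanish; commutativity of the shuffle product matters for `[η e₂,
    -- ζ e₁]`.
    fin_cases i <;> fin_cases j <;> ext w <;> simp [shuffleBracket, basisPair, mul_comm]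
  · rw [tri_infinitesimal_eq eps₁_mul_self eps₂_mul_self, curve_eq]
  · rw [feedbackBracket, hcomm]
    exact (mixedPart_infinitesimal _).symm
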